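/- Let $X$ and $Y$ be real separable reflexive Banach spaces, $X$ carrying its Borel $\sigma$-algebra, let $k\ge 1$, and equip $Y^k$ with the norm $\|\mu\|_k=\max_j\|\mu_j\|_Y$. (Reflexive means that the canonical embedding into the bidual is surjective.) Let $P$ be a Borel probability measure on $X$ and let $d:X\times Y\to[0,\infty)$, $r:Y^k\to[0,\infty)$ satisfy: 1. for every $y\in Y$, $\sup_{x\in\mathrm{supp}(P)}d(x,y)<\infty$; 2. whenever $x_m\to x$ in $X$ and $y_n\rightharpoonup y$ weakly in $Y$, $\liminf_{n,m\to\infty}d(x_m,y_n)\ge d(x,y)$ and $\lim_{m\to\infty}d(x_m,y)=d(x,y)$; 3. for every $y\in Y$, $d(\cdot,y)$ is Borel measurable; 4. $r$ is (sequentially) weakly lower semicontinuous: $\mu^n\rightharpoonup\mu$ implies $r(\mu)\le\liminf_n r(\mu^n)$; 5. $r$ is coercive: $r(\mu)\to\infty$ as $\|\mu\|_k\to\infty$. Fix $\lambda>0$ and let $\xi_1,\xi_2,\dots$ be independent $X$-valued random elements with common law $P$ on a probability space $(\Omega,\mathcal F,\mathbb P)$. For $\mu\in Y^k$ put $g_\mu(x)=\min_{1\le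 j\le k}d(x,\mu_j)$, $$f_n^{(\omega)}(\mu)=\frac1n\sum_{i=1}^n g_\mu(\xi_i(\omega))+\lambda r(\mu)\quad(n\ge1),\qquad f_\infty(\mu)=\int_X g_\mu\,dP+\lambda r(\mu).$$ Then each $g_\mu$ is $P$-integrable, so $f_\infty$ is finite; $f_\infty$ attains its minimum on $Y^k$; and for $\mathbb P$-almost every $\omega$: * for every $n\ge1$, $f_n^{(\omega)}$ attains its minimum on $Y^k$, and $$\lim_{n\to\infty}\min_{\mu\in Y^k}f_n^{(\omega)}(\mu)=\min_{\mu\in Y^k}f_\infty(\mu);$$ * for every sequence $(\mu^n)_{n\ge1}$ such that $\mu^n$ minimizes $f_n^{(\omega)}$ for all $n\ge1$, the sequence is weakly precompact in $Y^k$ (the weak closure of $\{\mu^n\}$ is weakly compact, and every subsequence has a weakly convergent further subsequence), and every weak limit point of $(\mu^n)$ (every point each of whose weak neighbourhoods contains $\mu^n$ for infinitely many $n$, in particular the weak limit of any subsequence) minimizes $f_\infty$ over $Y^k$. -/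

import Mathlib

open MeasureTheory ProbabilityTheory Filter Topology
open scoped NNReal ENNReal

namespace RegKMeans

/-- A real Banach space is reflexive if its canonical embedding into its bidual is onto. -/
def IsReflexive (E : Type*) [NormedAddCommGroup E] [NormedSpace ℝ E] : Prop :=
  Function.Surjective (NormedSpace.inclusionInDoubleDual ℝ E)

/-- Weak convergence of a sequence: `F (u n) → F x` for every bounded linear functional `F`. -/
def WeaklyTendsto {E : Type*} [NormedAddCommGroup E] [NormedSpace ℝ E]
    (u : ℕ → E) (x : E) : Prop :=
  ∀ F : StrongDual ℝ E, Tendsto (fun n => F (u n)) atTop (𝓝 (F x))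

/-- Weak convergence of sequences is convergence in the weak topology. -/
theorem weaklyTendsto_iff {E : Type*} [NormedAddCommGroup E] [NormedSpace ℝ E]
    (u : ℕ → E) (x : E) :
    WeaklyTendsto u x ↔
      Tendsto (fun n => toWeakSpace ℝ E (u n)) atTop (𝓝 (toWeakSpace ℝ E x)) := by
  have hinj : Function.Injective ((topDualPairing ℝ E).flip) := by
    intro a b hab
    refine (SeparatingDual.eq_iff_forall_dual_eq (R := ℝ)).2 fun F => ?_
    exact congrArg (fun (g : StrongDual ℝ E →ₗ[ℝ] ℝ) => g F) hab
  exact (WeakBilin.tendsto_iff_forall_eval_tendsto (topDualPairing ℝ E).flip hinj).symm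

/-- A sequence is weakly precompact if the closure of its range in the weak topology is compact
in the weak topology. -/
def WeaklyPrecompact {E : Type*} [NormedAddCommGroup E] [NormedSpace ℝ E] (u : ℕ → E) : Prop :=
  IsCompact (closure (Set.range fun n => toWeakSpace ℝ E (u n)))

/-- `x` is a weak limit point of the sequence `u`: every weak neighbourhood of `x` contains `u n`
for infinitely many `n`. In particular every weak limit of a subsequence is one. -/
def WeakLimitPoint {E : Type*} [NormedAddCommGroup E] [NormedSpace ℝ E]
    (u : ℕ → E) (x : E) : Prop :=
  MapClusterPt (toWeakSpace ℝ E x) atTop (fun n => toWeakSpace ℝ E (u n))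

section Energies

variable {X Y : Type*} {k : ℕ}

/-- `g_μ(x) = min_j d(x, μ_j)` (a minimum over a finite set, nonempty when `1 ≤ k`). -/
noncomputable def g (d : X → Y → ℝ≥0) (μ : Fin k → Y) (x : X) : ℝ≥0 :=
  ⨅ j, d x (μ j)

/-- The empirical energy `f_n(μ) = (1/n) ∑_{i=1}^n g_μ(ξ_i) + lam * r(μ)`;
the sample `ξ_1, …, ξ_n` is `ξ 0, …, ξ (n-1)`. -/
noncomputable def empiricalEnergy (d : X → Y → ℝ≥0) (r : (Fin k → Y) → ℝ≥0) (lam : ℝ)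
    (ξ : ℕ → X) (n : ℕ) (μ : Fin k → Y) : ℝ :=
  (1 / (n : ℝ)) * ∑ i ∈ Finset.range n, (g d μ (ξ i) : ℝ) + lam * r μ

/-- The limiting energy `f_∞(μ) = ∫ g_μ dP + lam * r(μ)`. -/
noncomputable def limitEnergy [MeasurableSpace X] (d : X → Y → ℝ≥0) (r : (Fin k → Y) → ℝ≥0)
    (lam : ℝ) (P : Measure X) (μ : Fin k → Y) : ℝ :=
  (∫ x, (g d μ x : ℝ) ∂P) + lam * r μ

end Energies

/-- The assumptions on the cost `d`, the regularizer `r` and the law `P`. The norm on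
`Fin k → Y` is the maximum norm. Lower limits are taken in `[0, ∞]`. -/
structure Assumptions {X Y : Type*} [NormedAddCommGroup X] [MeasurableSpace X]
    [NormedAddCommGroup Y] [NormedSpace ℝ Y] {k : ℕ}
    (d : X → Y → ℝ≥0) (r : (Fin k → Y) → ℝ≥0) (P : Measure X) : Prop where
  bounded_on_support : ∀ y, BddAbove ((fun x => d x y) '' P.support)
  /-- joint lower semicontinuity, the indices `m` and `n` tending to infinity independently -/
  liminf_cost : ∀ (x : X) (y : Y) (xs : ℕ → X) (ys : ℕ → Y),
    Tendsto xs atTop (𝓝 x) → WeaklyTendsto ys y →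
      (d x y : ℝ≥0∞) ≤
        liminf (fun p : ℕ × ℕ => (d (xs p.1) (ys p.2) : ℝ≥0∞)) (atTop ×ˢ atTop)
  continuous_cost : ∀ (x : X) (y : Y) (xs : ℕ → X),
    Tendsto xs atTop (𝓝 x) → Tendsto (fun m => d (xs m) y) atTop (𝓝 (d x y))
  measurable_cost : ∀ y, Measurable fun x => d x y
  weakly_lsc_reg : ∀ (μ : Fin k → Y) (u : ℕ → Fin k → Y), WeaklyTendsto u μ →
    (r μ : ℝ≥0∞) ≤ liminf (fun n => (r (u n) : ℝ≥0∞)) atTop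
  /-- `r(μ) → ∞` as `‖μ‖ → ∞` -/
  coercive_reg : Tendsto r (Bornology.cobounded (Fin k → Y)) atTop

end RegKMeans

/-!
The empirical energies Γ-converge almost surely to the limiting energy for weak convergence of
the centres, and are equi-coercive; the theorem then follows from the direct method.

*Compactness.* `Y ^ k` is reflexive and separable, so a bounded sequence is weakly precompact, and
countably many norming functionals metrize its weak closure. Hence weak limit points are limits of
subsequences (`WeakLimitPoint.exists_subseq`). Coercivity of `r` bounds the minimizers.

*Liminf inequality.* Almost surely the empirical measures `P_n` converge weakly to `P`
(`ae_tendsto_integral_empiricalMeasure`). If `u n ⇀ μ`, the functions `g_{u n}` have joint lower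
limit at least `g_μ` as the argument and the index vary together. Fatou's lemma for varying
measures (`eventually_lt_integral_of_tendsto`) then gives `∫ g_μ dP ≤ liminf ∫ g_{u n} dP_n`: the
truncated `m`-Lipschitz envelope of `(g_{u n})_{n ≥ m}` is bounded and continuous, hence may be
integrated against `P_n` in the limit, and these envelopes have lower limit at least `g_μ`
as `m → ∞`. For constant sequences of measures the same inequality is the weak lower
semicontinuity of a single energy, empirical or limiting, from which minimizers exist.

*Recovery sequences.* Constant sequences suffice: `g_μ` is continuous and bounded on the support
of `P`, which almost surely contains the sample, so `∫ g_μ dP_n → ∫ g_μ dP`.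
-/

namespace RegKMeans

/-! ### Weak sequential compactness in separable reflexive spaces -/

section Weak

variable {E : Type*} [NormedAddCommGroup E] [NormedSpace ℝ E]

/-- A functional `φ` on the dual of the product is determined by its restrictions
`F ↦ φ (F ∘ proj j)`, each of which is evaluation at a point of the `j`-th factor. -/
theorem IsReflexive.pi {ι : Type*} [Fintype ι] [DecidableEq ι] (hE : IsReflexive E) :
    IsReflexive (ι → E) := by
  intro φ
  have h : ∀ j : ι, ∃ y : E, ∀ F : StrongDual ℝ E,
      F y = φ (F.comp (ContinuousLinearMap.proj (R := ℝ) (φ := fun _ : ι => E) j)) := by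
    intro j
    obtain ⟨y, hy⟩ := hE (φ.comp ((ContinuousLinearMap.compL ℝ (ι → E) E ℝ).flip
      (ContinuousLinearMap.proj (R := ℝ) (φ := fun _ : ι => E) j)))
    exact ⟨y, fun F => congrArg (fun Φ : StrongDual ℝ (StrongDual ℝ E) => Φ F) hy⟩
  choose y hy using h
  refine ⟨y, ContinuousLinearMap.ext fun G => ?_⟩
  have hG : G = ∑ j, (G.comp (ContinuousLinearMap.single ℝ (fun _ : ι => E) j)).comp
      (ContinuousLinearMap.proj (R := ℝ) (φ := fun _ : ι => E) j) := by
    ext v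
    rw [sum_apply]
    simp only [ContinuousLinearMap.comp_apply, ContinuousLinearMap.single_apply,
      ContinuousLinearMap.proj_apply]
    rw [← map_sum, Finset.univ_sum_single v]
  rw [NormedSpace.dual_def]
  conv_rhs => rw [hG, map_sum]
  conv_lhs => rw [hG, sum_apply]
  refine Finset.sum_congr rfl fun j _ => ?_
  rw [← hy j]
  rfl

/-- In a reflexive space, bounded sequences are weakly precompact (Banach–Alaoglu). -/
theorem IsReflexive.weaklyPrecompact (hE : IsReflexive E) {u : ℕ → E} {R : ℝ}
    (hu : ∀ n, ‖u n‖ ≤ R) : WeaklyPrecompact u := by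
  refine NormedSpace.isCompact_closure_of_isBounded ℝ E _ ?_ ?_
  · refine (Metric.isBounded_closedBall (x := (0 : E)) (r := R)).subset ?_
    rintro x ⟨n, hn⟩
    rw [← (toWeakSpace ℝ E).injective hn]
    simpa using hu n
  · intro Φ _
    obtain ⟨y, hy⟩ := hE (WeakDual.toStrongDual Φ)
    exact ⟨toWeakSpace ℝ E y, hy⟩

/-- Norming functionals of a dense sequence separate the points of a separable normed space. -/
theorem exists_seq_dual_separating [TopologicalSpace.SeparableSpace E] :
    ∃ F : ℕ → StrongDual ℝ E, ∀ x y : E, x ≠ y → ∃ n, F n x ≠ F n y := by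
  choose F hF1 hF2 using fun n => exists_dual_vector'' ℝ (TopologicalSpace.denseSeq E n)
  refine ⟨F, fun x y hxy => ?_⟩
  by_contra! h
  have hpos : 0 < ‖x - y‖ := norm_pos_iff.2 (sub_ne_zero.2 hxy)
  obtain ⟨n, hn⟩ := (TopologicalSpace.denseRange_denseSeq E).exists_dist_lt (x - y)
    (half_pos hpos)
  set z := TopologicalSpace.denseSeq E n
  have h0 : F n (x - y) = 0 := by rw [map_sub, h n, sub_self]
  have h1 : ‖z‖ ≤ ‖x - y - z‖ := by
    have h2 : ‖F n (x - y - z)‖ ≤ 1 * ‖x - y - z‖ := (F n).le_of_opNorm_le (hF1 n) _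
    rw [map_sub, h0, hF2 n, zero_sub, norm_neg, one_mul] at h2
    simpa using h2
  have h3 : ‖x - y‖ ≤ ‖x - y - z‖ + ‖z‖ := by simpa using norm_add_le (x - y - z) z
  rw [dist_eq_norm] at hn
  linarith

theorem continuous_dual_weakSpace (F : StrongDual ℝ E) :
    Continuous fun x : WeakSpace ℝ E => F ((toWeakSpace ℝ E).symm x) :=
  WeakBilin.eval_continuous (topDualPairing ℝ E).flip F

/-- In a separable space, a weakly compact set is metrizable, so weak limit points of a weakly
precompact sequence are limits of subsequences. -/
theorem WeakLimitPoint.exists_subseq [TopologicalSpace.SeparableSpace E] {u : ℕ → E} {x : E}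
    (hu : WeaklyPrecompact u) (hx : WeakLimitPoint u x) :
    ∃ ψ : ℕ → ℕ, StrictMono ψ ∧ WeaklyTendsto (fun n => u (ψ n)) x := by
  set K := closure (Set.range fun n => toWeakSpace ℝ E (u n)) with hK
  have : CompactSpace K := isCompact_iff_compactSpace.1 hu
  obtain ⟨F, hF⟩ := exists_seq_dual_separating (E := E)
  have : TopologicalSpace.MetrizableSpace K := by
    refine Metric.PiNatEmbed.TopologicalSpace.MetrizableSpace.of_countable_separating (Y := fun _ : ℕ => ℝ)
      (fun n (z : K) => F n ((toWeakSpace ℝ E).symm z)) (fun n => ?_) (fun z w hzw => ?_)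
    · exact (continuous_dual_weakSpace (F n)).comp continuous_subtype_val
    · exact hF _ _ fun h => hzw (Subtype.ext ((toWeakSpace ℝ E).symm.injective h))
  have hxK : toWeakSpace ℝ E x ∈ K :=
    isClosed_closure.mem_of_mapClusterPt hx
      (Eventually.of_forall fun n => subset_closure ⟨n, rfl⟩)
  have hx' : MapClusterPt (⟨toWeakSpace ℝ E x, hxK⟩ : K) atTop
      (fun n => (⟨toWeakSpace ℝ E (u n), subset_closure ⟨n, rfl⟩⟩ : K)) :=
    (IsInducing.subtypeVal.mapClusterPt_iff (x := ⟨toWeakSpace ℝ E x, hxK⟩)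
      (l := map (fun n => (⟨toWeakSpace ℝ E (u n), subset_closure ⟨n, rfl⟩⟩ : K)) atTop)).1 hx
  obtain ⟨ψ, hψ, hlim⟩ := hx'.tendsto_subseq
  exact ⟨ψ, hψ, (weaklyTendsto_iff _ _).2 ((continuous_subtype_val.tendsto _).comp hlim)⟩

theorem WeaklyPrecompact.exists_subseq [TopologicalSpace.SeparableSpace E] {u : ℕ → E}
    (hu : WeaklyPrecompact u) :
    ∃ (ψ : ℕ → ℕ) (x : E), StrictMono ψ ∧ WeaklyTendsto (fun n => u (ψ n)) x := by
  obtain ⟨x, -, hx⟩ := hu.exists_mapClusterPt (f := atTop) (u := fun n => toWeakSpace ℝ E (u n))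
    (tendsto_principal.2 (Eventually.of_forall fun n => subset_closure ⟨n, rfl⟩))
  obtain ⟨ψ, hψ, h⟩ := WeakLimitPoint.exists_subseq (x := (toWeakSpace ℝ E).symm x) hu hx
  exact ⟨ψ, _, hψ, h⟩

end Weak

/-! ### Minimizers under variational convergence -/

section Gamma

variable {E : Type*} [NormedAddCommGroup E]

theorem ciInf_eq_of_isMinOn {α : Type*} [Nonempty α] {G : α → ℝ} {x : α} (h : IsMinOn G Set.univ x) : ⨅ y, G y = G x :=
  le_antisymm (ciInf_le ⟨G x, Set.forall_mem_range.2 (isMinOn_univ_iff.1 h)⟩ x)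
    (le_ciInf (isMinOn_univ_iff.1 h))

/-- Sublevel sets of the functionals `F n` are bounded, uniformly in `n`. -/
def EquiCoercive (F : ℕ → E → ℝ) : Prop :=
  ∀ C : ℝ, ∃ R : ℝ, ∀ n x, F n x ≤ C → ‖x‖ ≤ R

theorem bounded_of_isMinOn {F : ℕ → E → ℝ} {Finf : E → ℝ} (hco : EquiCoercive F)
    (hlim : ∀ x, Tendsto (fun n => F n x) atTop (𝓝 (Finf x))) {u : ℕ → E}
    (hu : ∀ n, 1 ≤ n → IsMinOn (F n) Set.univ (u n)) : ∃ R, ∀ n, ‖u n‖ ≤ R := by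
  obtain ⟨C, hC⟩ := (hlim 0).bddAbove_range
  obtain ⟨R, hR⟩ := hco C
  -- `u 0` is unconstrained
  refine ⟨max R ‖u 0‖, fun n => ?_⟩
  rcases Nat.eq_zero_or_pos n with rfl | hn
  · exact le_max_right _ _
  · exact (hR n _ ((isMinOn_univ_iff.1 (hu n hn) 0).trans
      (hC (Set.mem_range_self n)))).trans (le_max_left _ _)

variable [NormedSpace ℝ E]

/-- The liminf half of Γ-convergence for weakly convergent sequences, required along every
subsequence of the functionals: `F∞ x ≤ liminf F (φ n) (u n)` whenever `u n ⇀ x`. -/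
def LiminfInequality (F : ℕ → E → ℝ) (Finf : E → ℝ) : Prop :=
  ∀ (φ : ℕ → ℕ) (u : ℕ → E) (x : E), StrictMono φ → WeaklyTendsto u x →
    ∀ c < Finf x, ∀ᶠ n in atTop, c < F (φ n) (u n)

/-- The direct method: a coercive functional bounded below attains its minimum if it is
sequentially weakly lower semicontinuous. -/
theorem exists_isMinOn_of_liminfInequality [TopologicalSpace.SeparableSpace E]
    (hE : IsReflexive E) {F : E → ℝ} (hlsc : LiminfInequality (fun _ => F) F)
    (hco : EquiCoercive (fun _ : ℕ => F)) (hbdd : BddBelow (Set.range F)) :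
    ∃ x, IsMinOn F Set.univ x := by
  obtain ⟨v, hv_anti, hv_lim, hv_mem⟩ := exists_seq_tendsto_sInf (Set.range_nonempty F) hbdd
  choose u hu using hv_mem
  obtain ⟨R, hR⟩ := hco (v 0)
  obtain ⟨ψ, x, hψ, hx⟩ := (hE.weaklyPrecompact (u := u) (R := R)
    fun n => hR n _ ((hu n).trans_le (hv_anti (Nat.zero_le n)))).exists_subseq
  refine ⟨x, isMinOn_univ_iff.2 fun y => le_of_not_gt fun hlt => ?_⟩
  obtain ⟨c, hc1, hc2⟩ := exists_between hlt
  have h1 := hlsc id _ x strictMono_id hx c hc2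
  have h2 : ∀ᶠ n in atTop, v (ψ n) < c :=
    (hv_lim.comp hψ.tendsto_atTop).eventually_lt_const
      ((csInf_le hbdd (Set.mem_range_self y)).trans_lt hc1)
  obtain ⟨n, h1, h2⟩ := (h1.and h2).exists
  exact lt_asymm (h1.trans_eq (hu _)) h2

variable {F : ℕ → E → ℝ} {Finf : E → ℝ}

theorem isMinOn_of_weaklyTendsto (hliminf : LiminfInequality F Finf)
    (hlim : ∀ x, Tendsto (fun n => F n x) atTop (𝓝 (Finf x))) {u : ℕ → E}
    (hu : ∀ n, 1 ≤ n → IsMinOn (F n) Set.univ (u n)) {φ : ℕ → ℕ} (hφ : StrictMono φ) {x : E}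
    (hx : WeaklyTendsto (fun n => u (φ n)) x) : IsMinOn Finf Set.univ x := by
  refine isMinOn_univ_iff.2 fun y => le_of_not_gt fun hlt => ?_
  obtain ⟨c, hc1, hc2⟩ := exists_between hlt
  obtain ⟨n, ⟨h1, h2⟩, h3⟩ := ((hliminf φ _ x hφ hx c hc2).and
    (((hlim y).comp hφ.tendsto_atTop).eventually_lt_const hc1)).and
      (hφ.tendsto_atTop.eventually_ge_atTop 1) |>.exists
  exact absurd (h1.trans_le (isMinOn_univ_iff.1 (hu _ h3) y)) (lt_asymm h2)

theorem tendsto_iInf_of_liminfInequality [TopologicalSpace.SeparableSpace E]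
    (hE : IsReflexive E) (hliminf : LiminfInequality F Finf) (hco : EquiCoercive F)
    (hlim : ∀ x, Tendsto (fun n => F n x) atTop (𝓝 (Finf x)))
    (hmin : ∀ n, 1 ≤ n → ∃ x, IsMinOn (F n) Set.univ x)
    (hmininf : ∃ x, IsMinOn Finf Set.univ x) :
    Tendsto (fun n => ⨅ x, F n x) atTop (𝓝 (⨅ x, Finf x)) := by
  obtain ⟨z, hz⟩ := hmininf
  have hex : ∀ n, ∃ x, 1 ≤ n → IsMinOn (F n) Set.univ x := fun n => by
    by_cases hn : 1 ≤ n
    · exact (hmin n hn).imp fun _ h _ => h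
    · exact ⟨0, fun h => absurd h hn⟩
  choose u hu using hex
  rw [ciInf_eq_of_isMinOn hz]
  have heq : (fun n => F n (u n)) =ᶠ[atTop] fun n => ⨅ x, F n x := by
    filter_upwards [eventually_ge_atTop 1] with n hn
    exact (ciInf_eq_of_isMinOn (hu n hn)).symm
  refine Tendsto.congr' heq (tendsto_order.2 ⟨fun c hc => ?_, fun c hc => ?_⟩)
  · by_contra hnot
    obtain ⟨φ, hφ, hle⟩ := extraction_of_frequently_atTop (not_eventually.1 hnot)
    obtain ⟨R, hR⟩ := bounded_of_isMinOn hco hlim hu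
    obtain ⟨ψ, x, hψ, hx⟩ := (hE.weaklyPrecompact fun n => hR (φ n)).exists_subseq
    obtain ⟨n, hn⟩ := (hliminf (φ ∘ ψ) _ x (hφ.comp hψ) hx c
      (hc.trans_le (isMinOn_univ_iff.1 hz x))).exists
    exact hle (ψ n) hn
  · filter_upwards [(hlim z).eventually_lt_const hc, eventually_ge_atTop 1] with n h1 hn
    exact (isMinOn_univ_iff.1 (hu n hn) z).trans_lt h1

end Gamma

/-! ### Fatou's lemma along weakly convergent measures -/

section Fatou

variable {X : Type*}

/-- The `m`-Lipschitz envelope of the tail `(φ n)_{n ≥ m}` of a sequence of functions, truncated at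
height `m`. -/
noncomputable def tailEnvelope [PseudoMetricSpace X] (φ : ℕ → X → ℝ) (m : ℕ) (x : X) : ℝ :=
  ⨅ p : Set.Ici m × X, (min (φ p.1 p.2) m + m * dist x p.2)

variable [PseudoMetricSpace X] {φ : ℕ → X → ℝ}

theorem bddBelow_tailEnvelope (hφ : ∀ n x, 0 ≤ φ n x) (m : ℕ) (x : X) :
    BddBelow (Set.range fun p : Set.Ici m × X => min (φ p.1 p.2) (m : ℝ) + m * dist x p.2) :=
  ⟨0, Set.forall_mem_range.2 fun _ =>
    add_nonneg (le_min (hφ _ _) m.cast_nonneg) (mul_nonneg m.cast_nonneg dist_nonneg)⟩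

theorem tailEnvelope_nonneg (hφ : ∀ n x, 0 ≤ φ n x) (m : ℕ) (x : X) : 0 ≤ tailEnvelope φ m x :=
  Real.iInf_nonneg fun _ =>
    add_nonneg (le_min (hφ _ _) m.cast_nonneg) (mul_nonneg m.cast_nonneg dist_nonneg)

theorem tailEnvelope_le_min (hφ : ∀ n x, 0 ≤ φ n x) {m n : ℕ} (hmn : m ≤ n) (x : X) :
    tailEnvelope φ m x ≤ min (φ n x) m := by
  refine (ciInf_le (bddBelow_tailEnvelope hφ m x) (⟨n, hmn⟩, x)).trans ?_
  simp

theorem lipschitzWith_tailEnvelope (hφ : ∀ n x, 0 ≤ φ n x) (m : ℕ) :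
    LipschitzWith m (tailEnvelope φ m) := by
  refine LipschitzWith.of_le_add_mul _ fun x y => ?_
  have : Nonempty (Set.Ici m × X) := ⟨(⟨m, Set.self_mem_Ici⟩, x)⟩
  rw [← sub_le_iff_le_add]
  refine le_ciInf fun p => ?_
  rw [sub_le_iff_le_add]
  refine (ciInf_le (bddBelow_tailEnvelope hφ m x) p).trans ?_
  have := mul_le_mul_of_nonneg_left (dist_triangle x y p.2) (m.cast_nonneg (α := ℝ))
  simp only [NNReal.coe_natCast]
  linarith

/-- The envelopes recover any joint lower limit of the sequence. -/
theorem eventually_lt_tailEnvelope {x : X} {a : ℝ} (hφ : ∀ n x, 0 ≤ φ n x)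
    (hliminf : ∀ xs : ℕ → X, Tendsto xs atTop (𝓝 x) → ∀ c < a,
      ∀ᶠ p : ℕ × ℕ in atTop ×ˢ atTop, c < φ p.2 (xs p.1))
    {c : ℝ} (hc : c < a) : ∀ᶠ m in atTop, c < tailEnvelope φ m x := by
  by_contra hnot
  obtain ⟨σ, hσ, hle⟩ := extraction_of_frequently_atTop (not_eventually.1 hnot)
  obtain ⟨b, hcb, hba⟩ := exists_between hc
  have hex : ∀ i, ∃ p : Set.Ici (σ i) × X,
      min (φ p.1 p.2) (σ i : ℝ) + σ i * dist x p.2 < b := fun i => by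
    have : Nonempty (Set.Ici (σ i) × X) := ⟨(⟨σ i, Set.self_mem_Ici⟩, x)⟩
    exact exists_lt_of_ciInf_lt ((not_lt.1 (hle i)).trans_lt hcb)
  choose p hp using hex
  have hσ_real : Tendsto (fun i => (σ i : ℝ)) atTop atTop :=
    tendsto_natCast_atTop_atTop.comp hσ.tendsto_atTop
  -- the near-optimal base points are within `b / σ i` of `x`
  have hxs : Tendsto (fun i => (p i).2) atTop (𝓝 x) := by
    rw [tendsto_iff_dist_tendsto_zero]
    refine squeeze_zero' (Eventually.of_forall fun _ => dist_nonneg) ?_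
      (hσ_real.const_div_atTop b)
    filter_upwards [hσ_real.eventually_gt_atTop 0] with i hi
    rw [le_div_iff₀ hi, dist_comm, mul_comm]
    have := le_min (hφ (p i).1 (p i).2) hi.le
    linarith [hp i]
  have hns : Tendsto (fun i => ((p i).1 : ℕ)) atTop atTop :=
    tendsto_atTop_mono (fun i => (p i).1.2) hσ.tendsto_atTop
  have hev := (tendsto_id.prodMk hns).eventually (hliminf _ hxs b hba)
  obtain ⟨i, h1, h2⟩ := (hev.and (hσ_real.eventually_gt_atTop b)).exists
  have h3 : b < min (φ (p i).1 (p i).2) (σ i : ℝ) := lt_min h1 h2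
  have h4 : 0 ≤ (σ i : ℝ) * dist x (p i).2 := by positivity
  linarith [hp i]

/-- Fatou's lemma with varying measures: the measures converge weakly, and `G` lies below the
joint lower limit of `φ n x'` as `n → ∞` and `x' → x`. -/
theorem eventually_lt_integral_of_tendsto [MeasurableSpace X] [BorelSpace X]
    {P : Measure X} [IsFiniteMeasure P] {Q : ℕ → Measure X} [∀ n, IsFiniteMeasure (Q n)]
    (hQ : ∀ f : BoundedContinuousFunction X ℝ,
      Tendsto (fun n => ∫ x, f x ∂(Q n)) atTop (𝓝 (∫ x, f x ∂P)))
    (hφ : ∀ n x, 0 ≤ φ n x) (hφQ : ∀ n, Integrable (φ n) (Q n))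
    {G : X → ℝ} (hG0 : ∀ x, 0 ≤ G x) (hG : Integrable G P)
    (hliminf : ∀ (x : X) (xs : ℕ → X), Tendsto xs atTop (𝓝 x) → ∀ c < G x,
      ∀ᶠ p : ℕ × ℕ in atTop ×ˢ atTop, c < φ p.2 (xs p.1))
    {c : ℝ} (hc : c < ∫ x, G x ∂P) : ∀ᶠ n in atTop, c < ∫ x, φ n x ∂(Q n) := by
  let h : ℕ → BoundedContinuousFunction X ℝ := fun m =>
    BoundedContinuousFunction.ofNormedAddCommGroup (tailEnvelope φ m)
      (lipschitzWith_tailEnvelope hφ m).continuous m fun x => by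
        rw [Real.norm_of_nonneg (tailEnvelope_nonneg hφ m x)]
        exact (tailEnvelope_le_min hφ le_rfl x).trans (min_le_right _ _)
  have hlim : Tendsto (fun m => ∫ x, min (h m x) (G x) ∂P) atTop (𝓝 (∫ x, G x ∂P)) := by
    refine tendsto_integral_of_dominated_convergence G (fun m => ?_) hG (fun m => ?_) ?_
    · exact (h m).continuous.aestronglyMeasurable.inf hG.aestronglyMeasurable
    · refine Eventually.of_forall fun x => ?_
      rw [Real.norm_of_nonneg (le_min (a := h m x) (tailEnvelope_nonneg hφ m x) (hG0 x))]
      exact min_le_right _ _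
    · refine Eventually.of_forall fun x => tendsto_order.2 ⟨fun b hb => ?_, fun b hb => ?_⟩
      · filter_upwards [eventually_lt_tailEnvelope hφ (hliminf x) hb] with m hm
        exact lt_min hm hb
      · exact Eventually.of_forall fun m => (min_le_right _ _).trans_lt hb
  obtain ⟨m, hm⟩ := (hlim.eventually_const_lt hc).exists
  have hm' : c < ∫ x, h m x ∂P := by
    refine hm.trans_le (integral_mono ?_ ((h m).integrable P) fun x => min_le_left _ _)
    exact ((h m).integrable P).inf hG
  filter_upwards [(hQ (h m)).eventually_const_lt hm', eventually_ge_atTop m] with n hn hmn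
  exact hn.trans_le (integral_mono ((h m).integrable _) (hφQ n)
    fun x => (tailEnvelope_le_min hφ hmn x).trans (min_le_left _ _))

end Fatou

/-! ### Empirical measures -/

section Empirical

variable {X : Type*} [MeasurableSpace X]

/-- The empirical measure `(1/n) ∑_{i < n} δ_{x i}`; it is the zero measure for `n = 0`. -/
noncomputable def empiricalMeasure (x : ℕ → X) (n : ℕ) : Measure X :=
  (n : ℝ≥0∞)⁻¹ • ∑ i ∈ Finset.range n, Measure.dirac (x i)

theorem empiricalMeasure_apply (x : ℕ → X) (n : ℕ) {s : Set X} (hs : MeasurableSet s) :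
    empiricalMeasure x n s = (n : ℝ≥0∞)⁻¹ * ∑ i ∈ Finset.range n, s.indicator 1 (x i) := by
  simp [empiricalMeasure, Measure.dirac_apply' _ hs]

instance isFiniteMeasure_empiricalMeasure (x : ℕ → X) (n : ℕ) :
    IsFiniteMeasure (empiricalMeasure x n) := by
  refine ⟨?_⟩
  rw [empiricalMeasure_apply x n MeasurableSet.univ]
  rcases Nat.eq_zero_or_pos n with rfl | hn
  · simp
  · exact ENNReal.mul_lt_top (by simpa using hn) (by simp)

theorem isProbabilityMeasure_empiricalMeasure (x : ℕ → X) {n : ℕ} (hn : n ≠ 0) :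
    IsProbabilityMeasure (empiricalMeasure x n) := by
  refine ⟨?_⟩
  rw [empiricalMeasure_apply x n MeasurableSet.univ]
  simpa using ENNReal.inv_mul_cancel (by simpa using hn) (ENNReal.natCast_ne_top n)

variable [MeasurableSingletonClass X]

theorem integrable_empiricalMeasure (x : ℕ → X) (n : ℕ) (f : X → ℝ) :
    Integrable f (empiricalMeasure x n) := by
  rcases Nat.eq_zero_or_pos n with rfl | hn
  · simp [empiricalMeasure]
  · refine Integrable.smul_measure ?_ (by simpa using hn.ne')
    exact integrable_finsetSum_measure.2 fun i _ => integrable_dirac (by simp)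

theorem integral_empiricalMeasure (x : ℕ → X) (n : ℕ) (f : X → ℝ) :
    ∫ z, f z ∂(empiricalMeasure x n) = (1 / (n : ℝ)) * ∑ i ∈ Finset.range n, f (x i) := by
  rw [empiricalMeasure, integral_smul_measure,
    integral_finsetSum_measure fun i _ => integrable_dirac (by simp)]
  simp [integral_dirac]

/-- Almost surely, the empirical measures of an i.i.d. sample converge weakly to the common law
(Varadarajan). The strong law of large numbers is applied to the countable π-system of finite
intersections of basic open sets. -/
theorem ae_tendsto_integral_empiricalMeasure {X : Type*} [TopologicalSpace X] [T1Space X]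
    [SecondCountableTopology X] [HasOuterApproxClosed X] [MeasurableSpace X] [BorelSpace X]
    {P : Measure X} [IsProbabilityMeasure P]
    {Ω : Type*} [MeasurableSpace Ω] {Pr : Measure Ω} [IsProbabilityMeasure Pr]
    {ξ : ℕ → Ω → X} (hmeas : ∀ i, Measurable (ξ i))
    (hindep : iIndepFun ξ Pr) (hlaw : ∀ i, Measure.map (ξ i) Pr = P) :
    ∀ᵐ ω ∂Pr, ∀ f : BoundedContinuousFunction X ℝ,
      Tendsto (fun n => ∫ x, f x ∂(empiricalMeasure (fun i => ξ i ω) n)) atTop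
        (𝓝 (∫ x, f x ∂P)) := by
  set B := TopologicalSpace.countableBasis X
  have hB := TopologicalSpace.isBasis_countableBasis X
  set S : Set (Set X) := Set.sInter '' {t : Set (Set X) | t.Finite ∧ t ⊆ B} with hS
  have hScount : S.Countable :=
    (Set.countable_ofPred_finite_subset (TopologicalSpace.countable_countableBasis X)).image _
  have hSopen : ∀ s ∈ S, IsOpen s := by
    rintro _ ⟨t, ⟨ht, htB⟩, rfl⟩
    exact ht.isOpen_sInter fun s hs => hB.isOpen (htB hs)
  have hSpi : IsPiSystem S := by
    rintro _ ⟨t, ⟨ht, htB⟩, rfl⟩ _ ⟨t', ⟨ht', htB'⟩, rfl⟩ -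
    exact ⟨t ∪ t', ⟨ht.union ht', Set.union_subset htB htB'⟩, Set.sInter_union t t'⟩
  have hslln : ∀ s ∈ S, ∀ᵐ ω ∂Pr, Tendsto
      (fun n => (empiricalMeasure (fun i => ξ i ω) n).real s) atTop (𝓝 (P.real s)) := by
    intro s hs
    have hsm : MeasurableSet s := (hSopen s hs).measurableSet
    have hind : Measurable (s.indicator (1 : X → ℝ)) := measurable_one.indicator hsm
    have hident : ∀ i, IdentDistrib (ξ i) (ξ 0) Pr Pr := fun i =>
      ⟨(hmeas i).aemeasurable, (hmeas 0).aemeasurable, by rw [hlaw i, hlaw 0]⟩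
    have hint : Integrable (s.indicator (1 : X → ℝ)) P :=
      (integrable_const (1 : ℝ)).indicator hsm
    have hint0 : Integrable (fun ω => s.indicator (1 : X → ℝ) (ξ 0 ω)) Pr :=
      Integrable.comp_measurable (g := s.indicator (1 : X → ℝ)) (by rwa [hlaw 0]) (hmeas 0)
    have h := strong_law_ae_real (fun i ω => s.indicator (1 : X → ℝ) (ξ i ω)) hint0
      (fun i j hij => (hindep.indepFun hij).comp hind hind)
      (fun i => (hident i).comp hind)
    filter_upwards [h] with ω hω
    have hP : ∫ ω, s.indicator (1 : X → ℝ) (ξ 0 ω) ∂Pr = P.real s := by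
      rw [← integral_map (hmeas 0).aemeasurable (by rw [hlaw 0]; exact hint.aestronglyMeasurable),
        hlaw 0, integral_indicator_one hsm]
    rw [hP] at hω
    refine hω.congr fun n => ?_
    rw [← integral_indicator_one hsm, integral_empiricalMeasure, one_div, inv_mul_eq_div]
  filter_upwards [(ae_ball_iff hScount).2 hslln] with ω hω
  -- the empirical measure is a probability measure from `n = 1` on
  let Q : ℕ → ProbabilityMeasure X := fun n =>
    ⟨empiricalMeasure (fun i => ξ i ω) (n + 1),
      isProbabilityMeasure_empiricalMeasure _ n.succ_ne_zero⟩
  have hQ : Tendsto Q atTop (𝓝 (⟨P, inferInstance⟩ : ProbabilityMeasure X)) := by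
    refine hSpi.tendsto_probabilityMeasure_of_tendsto_of_mem
      (fun s hs => (hSopen s hs).measurableSet) (fun u hu x hx => ?_) (fun s hs => ?_)
    · obtain ⟨v, hvB, hxv, hvu⟩ := hB.exists_subset_of_mem_open hx hu
      exact ⟨v, ⟨{v}, ⟨Set.finite_singleton v, Set.singleton_subset_iff.2 hvB⟩,
        Set.sInter_singleton v⟩, (hB.isOpen hvB).mem_nhds hxv, hvu⟩
    · rw [← NNReal.tendsto_coe]
      exact (hω s hs).comp (tendsto_add_atTop_nat 1)
  intro f
  exact (tendsto_add_atTop_iff_nat 1).1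
    (ProbabilityMeasure.tendsto_iff_forall_integral_tendsto.1 hQ f)

end Empirical

/-! ### The `k`-means energies -/

theorem WeaklyTendsto.apply {Y : Type*} [NormedAddCommGroup Y] [NormedSpace ℝ Y] {k : ℕ}
    {u : ℕ → Fin k → Y} {μ : Fin k → Y} (h : WeaklyTendsto u μ) (j : Fin k) :
    WeaklyTendsto (fun n => u n j) (μ j) := fun F =>
  h (F.comp (ContinuousLinearMap.proj (R := ℝ) (φ := fun _ : Fin k => Y) j))

section Pointwise

variable {X Y : Type*} {k : ℕ} {d : X → Y → ℝ≥0}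

theorem g_le (d : X → Y → ℝ≥0) (μ : Fin k → Y) (x : X) (j : Fin k) : g d μ x ≤ d x (μ j) :=
  ciInf_le (OrderBot.bddBelow _) j

theorem bddBelow_range_limitEnergy [MeasurableSpace X]
    {r : (Fin k → Y) → ℝ≥0} {lam : ℝ} (hlam : 0 < lam) (Q : Measure X) :
    BddBelow (Set.range (limitEnergy d r lam Q)) :=
  ⟨0, Set.forall_mem_range.2 fun _ => add_nonneg (integral_nonneg fun _ => NNReal.coe_nonneg _)
    (mul_nonneg hlam.le (NNReal.coe_nonneg _))⟩

theorem limitEnergy_empiricalMeasure [MeasurableSpace X]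
    [MeasurableSingletonClass X] (d : X → Y → ℝ≥0) (r : (Fin k → Y) → ℝ≥0)
    (lam : ℝ) (x : ℕ → X) (n : ℕ) :
    limitEnergy d r lam (empiricalMeasure x n) = empiricalEnergy d r lam x n := by
  ext μ
  rw [limitEnergy, empiricalEnergy, integral_empiricalMeasure]

variable [NeZero k]

theorem exists_g_eq (d : X → Y → ℝ≥0) (μ : Fin k → Y) (x : X) : ∃ j, d x (μ j) = g d μ x :=
  exists_eq_ciInf_of_finite

theorem continuous_g [TopologicalSpace X] (hd : ∀ y, Continuous fun x => d x y)
    (μ : Fin k → Y) : Continuous (g d μ) := by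
  have h : g d μ = fun x => Finset.univ.inf' Finset.univ_nonempty fun j => d x (μ j) := by
    ext x
    rw [Finset.inf'_univ_eq_ciInf]
    rfl
  rw [h]
  exact Continuous.finset_inf'_apply _ fun j _ => hd (μ j)

end Pointwise

section Energy

variable {X Y : Type*} [NormedAddCommGroup X] [MeasurableSpace X]
  [NormedAddCommGroup Y] [NormedSpace ℝ Y] {k : ℕ}
  {d : X → Y → ℝ≥0} {r : (Fin k → Y) → ℝ≥0} {P : Measure X} {lam : ℝ}

theorem Assumptions.continuous (hass : Assumptions d r P) (y : Y) :
    Continuous fun x => d x y :=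
  SeqContinuous.continuous fun xs x h => hass.continuous_cost x y xs h

theorem Assumptions.eventually_lt_cost (hass : Assumptions d r P) {x : X} {y : Y} {xs : ℕ → X}
    {ys : ℕ → Y} (hx : Tendsto xs atTop (𝓝 x)) (hy : WeaklyTendsto ys y) {c : ℝ}
    (hc : c < d x y) : ∀ᶠ p : ℕ × ℕ in atTop ×ˢ atTop, c < d (xs p.1) (ys p.2) := by
  rcases lt_or_ge c 0 with hneg | hpos
  · exact Eventually.of_forall fun p => hneg.trans_le (NNReal.coe_nonneg _)
  lift c to ℝ≥0 using hpos
  have hc' : (c : ℝ≥0∞) < d x y := by exact_mod_cast hc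
  filter_upwards [eventually_lt_of_lt_liminf (hc'.trans_le (hass.liminf_cost x y xs ys hx hy))]
    with p hp
  exact_mod_cast hp

theorem Assumptions.eventually_lt_reg (hass : Assumptions d r P) {μ : Fin k → Y}
    {u : ℕ → Fin k → Y} (hu : WeaklyTendsto u μ) {c : ℝ} (hc : c < r μ) :
    ∀ᶠ n in atTop, c < r (u n) := by
  rcases lt_or_ge c 0 with hneg | hpos
  · exact Eventually.of_forall fun n => hneg.trans_le (NNReal.coe_nonneg _)
  lift c to ℝ≥0 using hpos
  have hc' : (c : ℝ≥0∞) < r μ := by exact_mod_cast hc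
  filter_upwards [eventually_lt_of_lt_liminf (hc'.trans_le (hass.weakly_lsc_reg μ u hu))]
    with n hn
  exact_mod_cast hn

theorem Assumptions.exists_bound_g [NeZero k] (hass : Assumptions d r P) (μ : Fin k → Y) :
    ∃ M : ℝ, ∀ x ∈ P.support, (g d μ x : ℝ) ≤ M := by
  obtain ⟨M, hM⟩ := hass.bounded_on_support (μ 0)
  exact ⟨M, fun x hx => by exact_mod_cast (g_le d μ x 0).trans (hM ⟨x, hx, rfl⟩)⟩

theorem Assumptions.eventually_lt_g [NeZero k] (hass : Assumptions d r P) {μ : Fin k → Y}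
    {u : ℕ → Fin k → Y} (hu : WeaklyTendsto u μ) {x : X} {xs : ℕ → X}
    (hx : Tendsto xs atTop (𝓝 x)) {c : ℝ} (hc : c < g d μ x) :
    ∀ᶠ p : ℕ × ℕ in atTop ×ˢ atTop, c < g d (u p.2) (xs p.1) := by
  have h : ∀ j, ∀ᶠ p : ℕ × ℕ in atTop ×ˢ atTop, c < d (xs p.1) (u p.2 j) := fun j =>
    hass.eventually_lt_cost hx (hu.apply j)
      (hc.trans_le (NNReal.coe_le_coe.2 (g_le d μ x j)))
  filter_upwards [eventually_all.2 h] with p hp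
  obtain ⟨j, hj⟩ := exists_g_eq d (u p.2) (xs p.1)
  rw [← hj]
  exact hp j

theorem equiCoercive_limitEnergy (hass : Assumptions d r P) (hlam : 0 < lam)
    (Q : ℕ → Measure X) : EquiCoercive fun n => limitEnergy d r lam (Q n) := by
  intro C
  obtain ⟨R, -, hR⟩ := (hasBasis_cobounded_norm (E := Fin k → Y)).eventually_iff.1
    (hass.coercive_reg.eventually_gt_atTop (C / lam).toNNReal)
  refine ⟨R, fun n μ hμ => le_of_not_gt fun hlt => ?_⟩
  have h1 : C / lam < r μ := (Real.le_coe_toNNReal _).trans_lt (NNReal.coe_lt_coe.2 (hR hlt.le))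
  have h2 : 0 ≤ ∫ x, (g d μ x : ℝ) ∂(Q n) := integral_nonneg fun _ => NNReal.coe_nonneg _
  rw [div_lt_iff₀' hlam] at h1
  simp only [limitEnergy] at hμ
  linarith

variable [BorelSpace X]

/-- The energies of weakly convergent measures satisfy the liminf inequality. The limit measure `P'`
need not be the law `P` of the assumptions: constant sequences of measures, empirical ones
included, yield lower semicontinuity of a single energy. -/
theorem liminfInequality_limitEnergy [NeZero k] (hass : Assumptions d r P) (hlam : 0 < lam)
    {P' : Measure X} [IsFiniteMeasure P'] {Q : ℕ → Measure X} [∀ n, IsFiniteMeasure (Q n)]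
    (hQ : ∀ f : BoundedContinuousFunction X ℝ,
      Tendsto (fun n => ∫ x, f x ∂(Q n)) atTop (𝓝 (∫ x, f x ∂P')))
    (hintQ : ∀ n (μ : Fin k → Y), Integrable (fun x => (g d μ x : ℝ)) (Q n))
    (hintP : ∀ μ : Fin k → Y, Integrable (fun x => (g d μ x : ℝ)) P') :
    LiminfInequality (fun n => limitEnergy d r lam (Q n)) (limitEnergy d r lam P') := by
  intro φ u μ hφ hu c hc
  set ε := (limitEnergy d r lam P' μ - c) / 2 with hε
  have hεpos : 0 < ε := by linarith
  have h1 : ∀ᶠ n in atTop,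
      (∫ x, (g d μ x : ℝ) ∂P') - ε < ∫ x, (g d (u n) x : ℝ) ∂(Q (φ n)) :=
    eventually_lt_integral_of_tendsto (fun f => (hQ f).comp hφ.tendsto_atTop)
      (fun _ _ => NNReal.coe_nonneg _) (fun n => hintQ _ _) (fun _ => NNReal.coe_nonneg _)
      (hintP μ) (fun x xs hxs c hc => hass.eventually_lt_g hu hxs hc) (by linarith)
  have h2 := hass.eventually_lt_reg hu (c := r μ - ε / lam)
    (by linarith [div_pos hεpos hlam])
  filter_upwards [h1, h2] with n h1 h2
  have h3 : lam * r μ - ε < lam * r (u n) := by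
    have := mul_lt_mul_of_pos_left h2 hlam
    rwa [mul_sub, mul_div_cancel₀ _ hlam.ne'] at this
  simp only [limitEnergy] at hε ⊢
  linarith

theorem exists_isMinOn_limitEnergy [NeZero k] [TopologicalSpace.SeparableSpace Y]
    (hY : IsReflexive Y) (hass : Assumptions d r P) (hlam : 0 < lam) (P' : Measure X)
    [IsFiniteMeasure P'] (hint : ∀ μ : Fin k → Y, Integrable (fun x => (g d μ x : ℝ)) P') :
    ∃ μ, IsMinOn (limitEnergy d r lam P') Set.univ μ :=
  exists_isMinOn_of_liminfInequality hY.pi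
    (liminfInequality_limitEnergy hass hlam (fun _ => tendsto_const_nhds) (fun _ => hint) hint)
    (equiCoercive_limitEnergy hass hlam fun _ => P') (bddBelow_range_limitEnergy hlam P')

variable [SecondCountableTopology X]

theorem Assumptions.integrable_g [NeZero k] [IsFiniteMeasure P] (hass : Assumptions d r P)
    (μ : Fin k → Y) : Integrable (fun x => (g d μ x : ℝ)) P := by
  obtain ⟨M, hM⟩ := hass.exists_bound_g μ
  refine Integrable.of_bound
    (NNReal.continuous_coe.comp (continuous_g hass.continuous μ)).aestronglyMeasurable M ?_
  filter_upwards [Measure.support_mem_ae (μ := P)] with x hx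
  rw [Real.norm_of_nonneg (NNReal.coe_nonneg _)]
  exact hM x hx

/-- Empirical averages of `g_μ` converge: on the support of `P`, where the sample lies, `g_μ` agrees
with a bounded continuous function. -/
theorem Assumptions.tendsto_limitEnergy [NeZero k] (hass : Assumptions d r P)
    (lam : ℝ) {x : ℕ → X} (hx : ∀ i, x i ∈ P.support)
    (hconv : ∀ f : BoundedContinuousFunction X ℝ,
      Tendsto (fun n => ∫ z, f z ∂(empiricalMeasure x n)) atTop (𝓝 (∫ z, f z ∂P)))
    (μ : Fin k → Y) :
    Tendsto (fun n => limitEnergy d r lam (empiricalMeasure x n) μ) atTop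
      (𝓝 (limitEnergy d r lam P μ)) := by
  obtain ⟨M, hM⟩ := hass.exists_bound_g μ
  have hM0 : 0 ≤ M := (NNReal.coe_nonneg _).trans (hM _ (hx 0))
  let f : BoundedContinuousFunction X ℝ := BoundedContinuousFunction.ofNormedAddCommGroup
    (fun z => min (g d μ z : ℝ) M)
    ((NNReal.continuous_coe.comp (continuous_g hass.continuous μ)).min continuous_const) M
    fun z => by
      rw [Real.norm_of_nonneg (le_min (NNReal.coe_nonneg _) hM0)]
      exact min_le_right _ _
  have hf : ∀ z ∈ P.support, f z = g d μ z := fun z hz => min_eq_left (hM z hz)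
  have hP : ∫ z, f z ∂P = ∫ z, (g d μ z : ℝ) ∂P := integral_congr_ae <| by
    filter_upwards [Measure.support_mem_ae (μ := P)] with z hz using hf z hz
  refine Tendsto.add_const _ ?_
  rw [← hP]
  refine (hconv f).congr fun n => ?_
  rw [integral_empiricalMeasure, integral_empiricalMeasure]
  simp only [hf _ (hx _)]

end Energy

end RegKMeans

theorem mainTheorem1
    {X : Type*} [NormedAddCommGroup X] [NormedSpace ℝ X] [CompleteSpace X]
    [TopologicalSpace.SeparableSpace X] (hX : RegKMeans.IsReflexive X)
    [MeasurableSpace X] [BorelSpace X]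
    {Y : Type*} [NormedAddCommGroup Y] [NormedSpace ℝ Y] [CompleteSpace Y]
    [TopologicalSpace.SeparableSpace Y] (hY : RegKMeans.IsReflexive Y)
    {k : ℕ} (hk : 1 ≤ k)
    (d : X → Y → ℝ≥0) (r : (Fin k → Y) → ℝ≥0)
    (P : Measure X) [IsProbabilityMeasure P]
    (hass : RegKMeans.Assumptions d r P)
    (lam : ℝ) (hlam : 0 < lam)
    {Ω : Type*} [MeasurableSpace Ω] (Pr : Measure Ω) [IsProbabilityMeasure Pr]
    (ξ : ℕ → Ω → X) (hmeas : ∀ i, Measurable (ξ i))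
    (hindep : iIndepFun ξ Pr) (hlaw : ∀ i, Measure.map (ξ i) Pr = P) :
    -- the limiting energy is finite and attains its minimum
    (∀ μ : Fin k → Y, Integrable (fun x => (RegKMeans.g d μ x : ℝ)) P) ∧
    (∃ μ : Fin k → Y, IsMinOn (RegKMeans.limitEnergy d r lam P) Set.univ μ) ∧
    ∀ᵐ ω ∂Pr,
      -- every empirical energy attains its minimum
      (∀ n : ℕ, 1 ≤ n → ∃ μ : Fin k → Y,
        IsMinOn (RegKMeans.empiricalEnergy d r lam (fun i => ξ i ω) n) Set.univ μ) ∧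
      -- the minima converge to the minimum of the limiting energy
      Tendsto (fun n : ℕ =>
          ⨅ μ : Fin k → Y, RegKMeans.empiricalEnergy d r lam (fun i => ξ i ω) n μ)
        atTop (𝓝 (⨅ μ : Fin k → Y, RegKMeans.limitEnergy d r lam P μ)) ∧
      -- sequences of minimizers
      ∀ u : ℕ → Fin k → Y,
        (∀ n : ℕ, 1 ≤ n →
          IsMinOn (RegKMeans.empiricalEnergy d r lam (fun i => ξ i ω) n) Set.univ (u n)) →
        RegKMeans.WeaklyPrecompact u ∧
        (∀ φ : ℕ → ℕ, StrictMono φ → ∃ (ψ : ℕ → ℕ) (μ : Fin k → Y), StrictMono ψ ∧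
          RegKMeans.WeaklyTendsto (fun n => u (φ (ψ n))) μ) ∧
        ∀ μ : Fin k → Y, RegKMeans.WeakLimitPoint u μ →
          IsMinOn (RegKMeans.limitEnergy d r lam P) Set.univ μ := by
  have : NeZero k := ⟨by omega⟩
  have : SecondCountableTopology X := UniformSpace.secondCountable_of_separable X
  have hint := hass.integrable_g
  have hmininf := RegKMeans.exists_isMinOn_limitEnergy hY hass hlam P hint
  refine ⟨hint, hmininf, ?_⟩
  have hsupp : ∀ᵐ ω ∂Pr, ∀ i, ξ i ω ∈ P.support := ae_all_iff.2 fun i =>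
    ae_of_ae_map (hmeas i).aemeasurable (by rw [hlaw i]; exact Measure.support_mem_ae)
  filter_upwards [hsupp, RegKMeans.ae_tendsto_integral_empiricalMeasure hmeas hindep hlaw]
    with ω hω hconv
  simp only [← RegKMeans.limitEnergy_empiricalMeasure]
  set Q := RegKMeans.empiricalMeasure fun i => ξ i ω
  have hintQ : ∀ n (μ : Fin k → Y), Integrable (fun x => (RegKMeans.g d μ x : ℝ)) (Q n) :=
    fun n _ => RegKMeans.integrable_empiricalMeasure _ n _
  have hliminf : RegKMeans.LiminfInequality (fun n => RegKMeans.limitEnergy d r lam (Q n))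
      (RegKMeans.limitEnergy d r lam P) :=
    RegKMeans.liminfInequality_limitEnergy hass hlam hconv hintQ hint
  have hco := RegKMeans.equiCoercive_limitEnergy hass hlam Q
  have hlim : ∀ μ, Tendsto (fun n => RegKMeans.limitEnergy d r lam (Q n) μ) atTop
      (𝓝 (RegKMeans.limitEnergy d r lam P μ)) := hass.tendsto_limitEnergy lam hω hconv
  have hmin : ∀ n, 1 ≤ n → ∃ μ, IsMinOn (RegKMeans.limitEnergy d r lam (Q n)) Set.univ μ :=
    fun n _ => RegKMeans.exists_isMinOn_limitEnergy hY hass hlam (Q n) (hintQ n)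
  refine ⟨hmin, RegKMeans.tendsto_iInf_of_liminfInequality hY.pi hliminf hco hlim hmin hmininf,
    fun u hu => ?_⟩
  obtain ⟨R, hR⟩ := RegKMeans.bounded_of_isMinOn hco hlim hu
  have hpre := hY.pi.weaklyPrecompact hR
  refine ⟨hpre, fun φ _ => (hY.pi.weaklyPrecompact fun n => hR (φ n)).exists_subseq,
    fun μ hμ => ?_⟩
  obtain ⟨ψ, hψ, hψμ⟩ := hμ.exists_subseq hpre
  exact RegKMeans.isMinOn_of_weaklyTendsto hliminf hlim hu hψ hψμ
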